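/- Theorem (existence of a hyper Nash equilibrium). Let $n\ge 0$, $m\ge 0$ and $K\ge 1$ be integers and let $R_l\ge 0$ and $R_1,\dots,R_n\ge 0$ be real numbers. Consider the single-leader-multiple-followers Stackelberg security game with targets $t_1,\dots,t_K$ in which the leader $l$ and the followers $i=1,\dots,n$ have the strategy sets $$\Omega_l=\Big\{x\in\mathbb{R}^K:\ \sum_{k=1}^K x^k=R_l,\ x^k\ge 0\ \forall k\Big\},\qquad \Omega_i=\Big\{y_i\in\mathbb{R}^K:\ \sum_{k=1}^K y_i^k=R_i,\ y_i^k\ge 0\ \forall k\Big\}.$$ Given real numbers $U_l^c(t_k),U_l^u(t_k)$ and real-valued functions $\theta\mapsto U_i^c(\theta,t_k)$, $\theta\mapsto U_i^u(\theta,t_k)$ of a parameter $\theta\in\mathbb{R}^m$, the utilities are $$U_l(x,\boldsymbol y)=\sum_{k=1}^K\Big(\sum_{i=1}^n y_i^k\Big)\big(x^kU_l^c(t_k)+(R_l-x^k)U_l^u(t_k)\big),$$ $$U_i(x,y_i,\theta)=\sum_{k=1}^K y_i^k\big(x^kU_i^c(\theta,t_k)+(R_l-x^k)U_i^u(\theta,t_k)\big),\qquad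 i=1,\dots,n.$$ Let $\mathcal G(\theta)$ denote this game at the parameter value $\theta$. Let $\Theta\subseteq\mathbb{R}^m$ be compact and convex with nonempty interior, let the true parameter $\theta_0$ lie in $\Theta$, and suppose that for all $i$ and $k$ the functions $\theta\mapsto U_i^c(\theta,t_k)$ and $\theta\mapsto U_i^u(\theta,t_k)$ are differentiable on $\Theta$. In the second-level hypergame $\mathcal H^2(\Theta)$ at an observation $\theta'\in\Theta$, the leader plays $\mathcal G(\theta_0)$ and knows that the followers play $\mathcal G(\theta')$, while every follower believes that all players play $\mathcal G(\theta')$. Then for every fixed $\theta'\in\Theta$ the hypergame $\mathcal H^2(\Theta)$ has a hyper Nash equilibrium, that is, there is a profile $(x^*,\boldsymbol y^*)\in\Omega_l\times\Omega_1\times\dots\times\Omega_n$ with $$x^*\in\operatorname*{argmax}_{x\in\Omega_l}U_l(x,\boldsymbol y^*)\qquad\text{and}\qquad y_i^*\in\operatorname*{argmax}_{y_i\in\Omega_i}U_i(x^*,y_i,\theta')\quad\text{for all } i=1,\dots,n.$$ -/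

import Mathlib

namespace SecurityGame

/-- The set of maximizers of `f` over `s`. -/
def argmax {α : Type*} (f : α → ℝ) (s : Set α) : Set α :=
  {a | a ∈ s ∧ ∀ b ∈ s, f b ≤ f a}

/-- The allocations of a total resource `R` to `K` targets. -/
def allocations (K : ℕ) (R : ℝ) : Set (Fin K → ℝ) :=
  {x | ∑ k, x k = R ∧ ∀ k, 0 ≤ x k}

/-- A single-leader-multiple-followers Stackelberg security game with `n` followers and `K`
targets, given by the resources of the players and their unit utilities at each target when
the leader covers it (`Covered`) and when the leader does not (`Uncovered`). -/
structure Game (n K : ℕ) where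
  leaderResource : ℝ
  followerResource : Fin n → ℝ
  leaderCovered : Fin K → ℝ
  leaderUncovered : Fin K → ℝ
  followerCovered : Fin n → Fin K → ℝ
  followerUncovered : Fin n → Fin K → ℝ

namespace Game

variable {n K : ℕ}

/-- The strategy set `Ω_l` of the leader. -/
def leaderStrategies (G : Game n K) : Set (Fin K → ℝ) :=
  allocations K G.leaderResource

/-- The strategy set `Ω_i` of the follower `i`. -/
def followerStrategies (G : Game n K) (i : Fin n) : Set (Fin K → ℝ) :=
  allocations K (G.followerResource i)

/-- The utility `U_l(x, y)` of the leader; `y i` is the strategy of the follower `i`. -/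
def leaderUtility (G : Game n K) (x : Fin K → ℝ) (y : Fin n → Fin K → ℝ) : ℝ :=
  ∑ k, (∑ i, y i k) *
    (x k * G.leaderCovered k + (G.leaderResource - x k) * G.leaderUncovered k)

/-- The utility `U_i(x, y_i)` of the follower `i`. -/
def followerUtility (G : Game n K) (i : Fin n) (x yi : Fin K → ℝ) : ℝ :=
  ∑ k, yi k *
    (x k * G.followerCovered i k + (G.leaderResource - x k) * G.followerUncovered i k)

end Game

/-- A security game in which the unit utilities of the followers (and nothing else) depend on a
parameter `θ ∈ ℝᵐ`. -/
structure ParametricGame (n K m : ℕ) where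
  leaderResource : ℝ
  followerResource : Fin n → ℝ
  leaderCovered : Fin K → ℝ
  leaderUncovered : Fin K → ℝ
  followerCovered : Fin n → EuclideanSpace ℝ (Fin m) → Fin K → ℝ
  followerUncovered : Fin n → EuclideanSpace ℝ (Fin m) → Fin K → ℝ

/-- A second-level hypergame, listed through the subjective games that form it. The leader has a
view of its own game and of the game that each follower plays; each follower has a view of the
game that the leader plays and of its own game. -/
structure SecondLevelHypergame (n K : ℕ) where
  /-- `G_ll`, the leader's game in the leader's view -/
  leaderGameByLeader : Game n K
  /-- `G_il`, the game of the follower `i` in the leader's view -/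
  followerGameByLeader : Fin n → Game n K
  /-- `G_li`, the leader's game in the view of the follower `i` -/
  leaderGameByFollower : Fin n → Game n K
  /-- `G_ii`, the game of the follower `i` in its own view -/
  followerGameByFollower : Fin n → Game n K

/-- `(x, y)` is a hyper Nash equilibrium: the strategy of every player is a best response to the
strategies of the others in the game that this player believes to be playing. -/
def SecondLevelHypergame.IsHyperNash {n K : ℕ} (H : SecondLevelHypergame n K)
    (x : Fin K → ℝ) (y : Fin n → Fin K → ℝ) : Prop :=
  x ∈ argmax (fun x' => H.leaderGameByLeader.leaderUtility x' y)
      H.leaderGameByLeader.leaderStrategies ∧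
    ∀ i, y i ∈ argmax (fun yi => (H.followerGameByFollower i).followerUtility i x yi)
      ((H.followerGameByFollower i).followerStrategies i)

namespace ParametricGame

variable {n K m : ℕ}

/-- The game `G(θ)` under the observation `θ` of the parameter. -/
def game (G : ParametricGame n K m) (θ : EuclideanSpace ℝ (Fin m)) : Game n K where
  leaderResource := G.leaderResource
  followerResource := G.followerResource
  leaderCovered := G.leaderCovered
  leaderUncovered := G.leaderUncovered
  followerCovered i k := G.followerCovered i θ k
  followerUncovered i k := G.followerUncovered i θ k

/-- The second-level hypergame `H²(Θ)` with true parameter `θ₀`, at an observation `θ' ∈ Θ` of the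
followers. The leader knows `θ₀` and that the followers observe `θ'`; the followers take `θ'` for
the parameter of all players. -/
def hypergame (G : ParametricGame n K m) (Θ : Set (EuclideanSpace ℝ (Fin m)))
    (θ₀ : EuclideanSpace ℝ (Fin m)) (θ' : Θ) : SecondLevelHypergame n K where
  leaderGameByLeader := G.game θ₀
  followerGameByLeader _ := G.game θ'
  leaderGameByFollower _ := G.game θ'
  followerGameByFollower _ := G.game θ'

end ParametricGame

end SecurityGame

/-! The leader's data do not depend on the parameter, so an equilibrium of the hypergame is a Nash
equilibrium of the game at `θ'`. Each utility is affine in the player's own strategy, so a strategy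
supported on targets of maximal value is optimal; after scaling by the resources, all strategies lie
in one simplex (`sum_mul_le_sum_smul_mul`).

Followers interact with the leader only. Replacing their best replies by continuous `ε`-best replies
leaves a continuous payoff vector `g` on the leader's simplex, and it suffices to find a point whose
non-negligible coordinates are almost maximal for `g` (`exists_mem_stdSimplex_approx_max`);
compactness then lets `ε → 0` (`exists_star_equilibrium`).

Such a point comes from Scarf's lemma on a fine grid of the simplex, each grid point being colored
by a coordinate where `g` is largest. Scarf's lemma itself is a parity count of rooms (full dominant
sets) and doors (dominant sets one element smaller). -/

namespace Scarf

/-! ### Rooms and doors of dominant sets. -/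

open Finset

variable {X I : Type*}

/-- No element of `X` lies, in all the orders given by the ranks `r i`, strictly above some element
of `P`. -/
def Dominant (r : I → X → ℕ) (P : Finset X) : Prop :=
  ∀ y, ∃ i, ∀ x ∈ P, r i y ≤ r i x

theorem Dominant.mono {r : I → X → ℕ} {P Q : Finset X} (h : Dominant r P) (hQ : Q ⊆ P) :
    Dominant r Q := fun y =>
  let ⟨i, hi⟩ := h y
  ⟨i, fun x hx => hi x (hQ hx)⟩

/-- `x` is the greatest, for the order `a`, of the elements that lie above `m j` in every other
order `j`. -/
def IsEntering (r : I → X → ℕ) (m : I → X) (a : I) (x : X) : Prop :=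
  (∀ j, j ≠ a → r j (m j) < r j x) ∧
    ∀ y, (∀ j, j ≠ a → r j (m j) < r j y) → r a y ≤ r a x

theorem IsEntering.unique {r : I → X → ℕ} (hr : ∀ i, Function.Injective (r i)) {m : I → X} {a : I}
    {x y : X} (hx : IsEntering r m a x) (hy : IsEntering r m a y) : x = y :=
  hr a (le_antisymm (hy.2 x hx.1) (hx.2 y hy.1))

theorem exists_isEntering [Finite X] (r : I → X → ℕ) (m : I → X) (a : I)
    (h : ∃ y, ∀ j, j ≠ a → r j (m j) < r j y) : ∃ x, IsEntering r m a x := by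
  obtain ⟨x, hx, hmax⟩ := Set.exists_max_image {y | ∀ j, j ≠ a → r j (m j) < r j y} (r a)
    (Set.toFinite _) h
  exact ⟨x, hx, fun y hy => hmax y hy⟩

theorem IsEntering.ne {r : I → X → ℕ} {Q : Finset X} (hQ : Dominant r Q) {m : I → X}
    (hmem : ∀ i, m i ∈ Q) {a b : I} (hab : a ≠ b) {x y : X}
    (hx : IsEntering r m a x) (hy : IsEntering r m b y) : x ≠ y := by
  rintro rfl
  obtain ⟨i, hi⟩ := hQ x
  by_cases hia : i = a
  · exact absurd (hi _ (hmem i)) (not_le.2 (hy.1 i (hia ▸ hab)))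
  · exact absurd (hi _ (hmem i)) (not_le.2 (hx.1 i hia))

/-- Pigeonhole: a door has one element fewer than there are orders. Only the two orders sharing a
minimum can receive a new element. -/
theorem exists_min_collision [Fintype I] (r : I → X → ℕ) {Q : Finset X}
    (hcard : #Q + 1 = Fintype.card I) (hne : Q.Nonempty) :
    ∃ m : I → X, (∀ i, m i ∈ Q) ∧ (∀ i, ∀ x ∈ Q, r i (m i) ≤ r i x) ∧
      ∃ a b, a ≠ b ∧ m a = m b := by
  choose m hmem hmin using fun i => exists_min_image Q (r i) hne
  obtain ⟨a, -, b, -, hab, hm⟩ := exists_ne_map_eq_of_card_lt_of_maps_to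
    (s := (univ : Finset I)) (t := Q) (by rw [card_univ]; omega) (f := m) (fun i _ => hmem i)
  exact ⟨m, hmem, hmin, a, b, hab, hm⟩

variable [DecidableEq X]

theorem IsEntering.notMem_and_dominant {r : I → X → ℕ} (hr : ∀ i, Function.Injective (r i))
    {Q : Finset X} (hQ : Dominant r Q) {m : I → X} (hmem : ∀ i, m i ∈ Q)
    (hmin : ∀ i, ∀ x ∈ Q, r i (m i) ≤ r i x) {a b : I} (hab : a ≠ b) (hm : m a = m b) {x : X}
    (hx : IsEntering r m a x) : x ∉ Q ∧ Dominant r (insert x Q) := by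
  constructor
  · intro hxQ
    obtain ⟨i, hi⟩ := hQ x
    have hxi : x = m i := hr i (le_antisymm (hi _ (hmem i)) (hmin i x hxQ))
    by_cases hia : i = a
    · have := hx.1 b hab.symm
      rw [hxi, hia, hm] at this
      exact lt_irrefl _ this
    · have := hx.1 i hia
      rw [← hxi] at this
      exact lt_irrefl _ this
  · intro y
    by_cases hy : ∀ j, j ≠ a → r j (m j) < r j y
    · refine ⟨a, fun z hz => ?_⟩
      rcases mem_insert.1 hz with rfl | hz
      · exact hx.2 y hy
      · obtain ⟨i, hi⟩ := hQ y
        by_cases hia : i = a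
        · exact hia ▸ hi z hz
        · exact absurd (hi _ (hmem i)) (not_le.2 (hy i hia))
    · push Not at hy
      obtain ⟨j, hja, hj⟩ := hy
      refine ⟨j, fun z hz => ?_⟩
      rcases mem_insert.1 hz with rfl | hz
      · exact hj.trans (hx.1 j hja).le
      · exact hj.trans (hmin j z hz)

/-- Sending each element of the room to an order witnessing its dominance is a bijection onto `I`,
and each element is the minimum of its order. Hence `m j` has label `j` unless `j` is the label of
`x`; as `m a = m b`, that label is `a` or `b`. -/
theorem isEntering_of_dominant_insert [Fintype I] {r : I → X → ℕ}
    (hr : ∀ i, Function.Injective (r i)) {Q : Finset X} (hcard : #Q + 1 = Fintype.card I)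
    {m : I → X} (hmem : ∀ i, m i ∈ Q)
    (hmin : ∀ i, ∀ x ∈ Q, r i (m i) ≤ r i x) {a b : I} (hab : a ≠ b) (hm : m a = m b) {x : X}
    (hxQ : x ∉ Q) (hx : Dominant r (insert x Q)) : IsEntering r m a x ∨ IsEntering r m b x := by
  choose s hs using hx
  have hinj : Set.InjOn s (insert x Q : Finset X) := fun y hy z hz hyz =>
    hr (s y) (le_antisymm (hs y z hz) (hyz ▸ hs z y hy))
  classical
  have himg : (insert x Q).image s = univ := by
    rw [← card_eq_iff_eq_univ, card_image_of_injOn hinj, card_insert_of_notMem hxQ, hcard]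
  have key : ∀ j, j ≠ s x → s (m j) = j := by
    intro j hj
    obtain ⟨q, hq, hqj⟩ := mem_image.1 (himg ▸ mem_univ j)
    rcases mem_insert.1 hq with rfl | hq
    · exact absurd hqj.symm hj
    · have : q = m j := hr j (le_antisymm
        (hqj ▸ hs q _ (mem_insert_of_mem (hmem _))) (hmin j q hq))
      rw [← this, hqj]
  have lt : ∀ j, j ≠ s x → r j (m j) < r j x := by
    intro j hj
    refine lt_of_le_of_ne ?_ fun h => hxQ (hr j h ▸ hmem j)
    have := hs (m j) x (mem_insert_self _ _)
    rwa [key j hj] at this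
  have ent : IsEntering r m (s x) x := by
    refine ⟨lt, fun y hy => ?_⟩
    by_cases h : s y = s x
    · exact h ▸ hs y x (mem_insert_self _ _)
    · exact absurd (hs y _ (mem_insert_of_mem (hmem (s y)))) (not_le.2 (hy _ h))
  by_cases ha : a = s x
  · exact Or.inl (ha ▸ ent)
  by_cases hb : b = s x
  · exact Or.inr (hb ▸ ent)
  exact absurd ((key a ha).symm.trans ((congrArg s hm).trans (key b hb))) hab

variable [Fintype X] [Fintype I]

open Classical in
/-- The dominant sets of full size that contain `Q`. -/
noncomputable def roomsOver (r : I → X → ℕ) (Q : Finset X) : Finset (Finset X) :=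
  {P | (#P = Fintype.card I ∧ Dominant r P) ∧ Q ⊆ P}

theorem mem_roomsOver_iff {r : I → X → ℕ} {P Q : Finset X} (hcard : #Q + 1 = Fintype.card I) :
    P ∈ roomsOver r Q ↔ ∃ x, x ∉ Q ∧ Dominant r (insert x Q) ∧ insert x Q = P := by
  simp only [roomsOver, mem_filter, mem_univ, true_and]
  constructor
  · rintro ⟨⟨hP, hd⟩, hQP⟩
    obtain ⟨x, hx, rfl⟩ := exists_eq_insert_iff.2 ⟨hQP, by omega⟩
    exact ⟨x, hx, hd, rfl⟩
  · rintro ⟨x, hx, hd, rfl⟩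
    exact ⟨⟨by rw [card_insert_of_notMem hx, hcard], hd⟩, subset_insert _ _⟩

theorem card_roomsOver_eq_two {r : I → X → ℕ} (hr : ∀ i, Function.Injective (r i))
    {Q : Finset X} (hQ : Dominant r Q) (hcard : #Q + 1 = Fintype.card I) (hne : Q.Nonempty)
    (hout : ∀ a, ∃ y, ∀ j, j ≠ a → ∃ q ∈ Q, r j q < r j y) : #(roomsOver r Q) = 2 := by
  obtain ⟨m, hmem, hmin, a, b, hab, hm⟩ := exists_min_collision r hcard hne
  have hex : ∀ a, ∃ x, IsEntering r m a x := fun a => exists_isEntering r m a <| by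
    obtain ⟨y, hy⟩ := hout a
    refine ⟨y, fun j hj => ?_⟩
    obtain ⟨q, hq, hlt⟩ := hy j hj
    exact (hmin j q hq).trans_lt hlt
  obtain ⟨x, hx⟩ := hex a
  obtain ⟨y, hy⟩ := hex b
  obtain ⟨hxQ, hxd⟩ := hx.notMem_and_dominant hr hQ hmem hmin hab hm
  obtain ⟨hyQ, hyd⟩ := hy.notMem_and_dominant hr hQ hmem hmin hab.symm hm.symm
  have hxy := hx.ne hQ hmem hab hy
  rw [card_eq_two]
  refine ⟨insert x Q, insert y Q, fun h => hxy ?_, ?_⟩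
  · exact (insert_inj hxQ).1 h
  ext P
  rw [mem_roomsOver_iff hcard, mem_insert, mem_singleton]
  constructor
  · rintro ⟨z, hz, hd, rfl⟩
    rcases isEntering_of_dominant_insert hr hcard hmem hmin hab hm hz hd with h | h
    · exact Or.inl (by rw [h.unique hr hx])
    · exact Or.inr (by rw [h.unique hr hy])
  · rintro (rfl | rfl)
    exacts [⟨x, hxQ, hxd, rfl⟩, ⟨y, hyQ, hyd, rfl⟩]

/-- The exceptional case in which one of the two orders admits no entering element. -/
theorem card_roomsOver_eq_one {r : I → X → ℕ} (hr : ∀ i, Function.Injective (r i))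
    {Q : Finset X} (hQ : Dominant r Q) (hcard : #Q + 1 = Fintype.card I)
    {m : I → X} (hmem : ∀ i, m i ∈ Q)
    (hmin : ∀ i, ∀ x ∈ Q, r i (m i) ≤ r i x) {a b : I} (hab : a ≠ b) (hm : m a = m b)
    (ha : ∃ y, ∀ j, j ≠ a → r j (m j) < r j y)
    (hb : ∀ y, ∃ j, j ≠ b ∧ r j y ≤ r j (m j)) : #(roomsOver r Q) = 1 := by
  obtain ⟨x, hx⟩ := exists_isEntering r m a ha
  obtain ⟨hxQ, hxd⟩ := hx.notMem_and_dominant hr hQ hmem hmin hab hm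
  rw [card_eq_one]
  refine ⟨insert x Q, ?_⟩
  ext P
  rw [mem_roomsOver_iff hcard, mem_singleton]
  constructor
  · rintro ⟨z, hz, hd, rfl⟩
    rcases isEntering_of_dominant_insert hr hcard hmem hmin hab hm hz hd with h | h
    · rw [h.unique hr hx]
    · obtain ⟨j, hj, hle⟩ := hb z
      exact absurd (h.1 j hj) (not_lt.2 hle)
  · rintro rfl
    exact ⟨x, hxQ, hxd, rfl⟩

variable [DecidableEq I]

open Classical in
/-- The dominant subsets of `P` with one element less than full size whose colors are all but
`i₀`. -/
noncomputable def doorsUnder (r : I → X → ℕ) (c : X → I) (i₀ : I) (P : Finset X) :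
    Finset (Finset X) :=
  {Q | (#Q + 1 = Fintype.card I ∧ Dominant r Q ∧ Q.image c = univ.erase i₀) ∧ Q ⊆ P}

/-- If such a room has a door, exactly one color occurs twice, and the doors are obtained by
deleting either of its two bearers. -/
theorem even_card_doorsUnder {r : I → X → ℕ} {c : X → I} {i₀ : I} {P : Finset X}
    (hP : #P = Fintype.card I) (hd : Dominant r P) (hc : P.image c ≠ univ) :
    Even #(doorsUnder r c i₀ P) := by
  rcases (doorsUnder r c i₀ P).eq_empty_or_nonempty with h | ⟨Q, hQ⟩
  · simp [h]
  simp only [doorsUnder, mem_filter, mem_univ, true_and] at hQ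
  obtain ⟨⟨hQc, hQd, hQi⟩, hQP⟩ := hQ
  obtain ⟨x, hx, rfl⟩ := exists_eq_insert_iff.2 ⟨hQP, by omega⟩
  have hxi : c x ≠ i₀ := by
    intro h
    apply hc
    rw [image_insert, hQi, h, insert_erase (mem_univ _)]
  obtain ⟨q, hq, hqx⟩ := mem_image.1 (hQi ▸ mem_erase.2 ⟨hxi, mem_univ _⟩ : c x ∈ Q.image c)
  have hne : q ≠ x := fun h => hx (h ▸ hq)
  have himg : ((insert x Q).erase q).image c = univ.erase i₀ := by
    rw [← hQi]
    ext j
    simp only [mem_image, mem_erase, mem_insert]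
    constructor
    · rintro ⟨z, ⟨-, rfl | hz⟩, rfl⟩
      exacts [⟨q, hq, hqx⟩, ⟨z, hz, rfl⟩]
    · rintro ⟨z, hz, rfl⟩
      by_cases h : z = q
      · exact ⟨x, ⟨hne.symm, Or.inl rfl⟩, by rw [h, hqx]⟩
      · exact ⟨z, ⟨h, Or.inr hz⟩, rfl⟩
  have : doorsUnder r c i₀ (insert x Q) = {Q, (insert x Q).erase q} := by
    ext Q'
    simp only [doorsUnder, mem_filter, mem_univ, true_and, mem_insert, mem_singleton]
    constructor
    · rintro ⟨⟨hc', hd', hi'⟩, hsub⟩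
      have hinj : Set.InjOn c Q' := by
        rw [← card_image_iff, hi', card_erase_of_mem (mem_univ _), card_univ]
        omega
      obtain ⟨z, hz, hzQ⟩ := exists_eq_insert_iff.2 ⟨hsub, by omega⟩
      have hQ' : Q' = (insert x Q).erase z := by rw [← hzQ, erase_insert hz]
      by_cases hzx : z = x
      · left; rw [hQ', hzx, erase_insert hx]
      by_cases hzq : z = q
      · right; rw [hQ', hzq]
      refine absurd (hinj ?_ ?_ hqx) hne
      · rw [mem_coe, hQ']; exact mem_erase.2 ⟨Ne.symm hzq, mem_insert_of_mem hq⟩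
      · rw [mem_coe, hQ']; exact mem_erase.2 ⟨Ne.symm hzx, mem_insert_self _ _⟩
    · rintro (rfl | rfl)
      · exact ⟨⟨hQc, hQd, hQi⟩, hQP⟩
      · refine ⟨⟨?_, hd.mono (erase_subset _ _), himg⟩, erase_subset _ _⟩
        rw [card_erase_add_one (mem_insert_of_mem hq), hP]
  rw [this, card_pair]
  · exact even_two
  · intro h
    have : q ∈ (insert x Q).erase q := h ▸ hq
    simp at this

theorem sum_card_doorsUnder (r : I → X → ℕ) (c : X → I) (i₀ : I) :
    open Classical in
    ∑ P : Finset X with #P = Fintype.card I ∧ Dominant r P, #(doorsUnder r c i₀ P) =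
      ∑ Q : Finset X with #Q + 1 = Fintype.card I ∧ Dominant r Q ∧ Q.image c = univ.erase i₀,
        #(roomsOver r Q) := by
  classical
  have := sum_card_bipartiteAbove_eq_sum_card_bipartiteBelow (fun P Q : Finset X => Q ⊆ P)
    (s := {P : Finset X | #P = Fintype.card I ∧ Dominant r P})
    (t := {Q : Finset X | #Q + 1 = Fintype.card I ∧ Dominant r Q ∧ Q.image c = univ.erase i₀})
  simp only [bipartiteAbove, bipartiteBelow, filter_filter] at this
  convert this using 3 <;> ext <;> simp [doorsUnder, roomsOver]

end Scarf

/-! ### Slack elements and Scarf's lemma. -/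

namespace Scarf

open Finset

/-- The ranks `r` extended to one more element for each order `i`, which is last in the order `i`
and above `T` in the other orders. -/
def slackRank {T I : Type*} [DecidableEq I] (r : I → T → ℕ) (e : I → ℕ) (B : ℕ) (i : I) :
    T ⊕ I → ℕ
  | Sum.inl t => r i t + 1
  | Sum.inr j => if j = i then 0 else B + 1 + e j

section

variable {T I : Type*} [DecidableEq I] {r : I → T → ℕ} {e : I → ℕ} {B : ℕ}

theorem slackRank_injective (hr : ∀ i, Function.Injective (r i)) (he : Function.Injective e)
    (hB : ∀ i t, r i t < B) (i : I) : Function.Injective (slackRank r e B i) := by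
  rintro (s | s) (t | t) h <;> simp only [slackRank] at h
  · exact congrArg _ (hr i (by omega))
  · have := hB i s
    split_ifs at h
    omega
  · have := hB i t
    split_ifs at h
    omega
  · split_ifs at h with h₁ h₂ h₂
    · rw [h₁, h₂]
    · omega
    · omega
    · exact congrArg _ (he (by omega))

variable [Fintype T] [Fintype I] [DecidableEq T]

theorem card_roomsOver_slack [Nontrivial I] (hr : ∀ i, Function.Injective (r i))
    (he : Function.Injective e) (hB : ∀ i t, r i t < B) (i₀ : I) :
    Dominant (slackRank r e B) ((univ.erase i₀).image (Sum.inr : I → T ⊕ I)) ∧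
      #((univ.erase i₀).image (Sum.inr : I → T ⊕ I)) + 1 = Fintype.card I ∧
      #(roomsOver (slackRank r e B) ((univ.erase i₀).image (Sum.inr : I → T ⊕ I))) = 1 := by
  have hmemQ : ∀ {x : T ⊕ I}, x ∈ (univ.erase i₀).image (Sum.inr : I → T ⊕ I) ↔
      ∃ j, j ≠ i₀ ∧ x = Sum.inr j := by
    intro x
    simp [eq_comm]
  have hdom : Dominant (slackRank r e B) ((univ.erase i₀).image (Sum.inr : I → T ⊕ I)) := by
    rintro (t | j)
    · refine ⟨i₀, fun x hx => ?_⟩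
      obtain ⟨j, hj, rfl⟩ := hmemQ.1 hx
      have := hB i₀ t
      simp only [slackRank, if_neg hj]
      omega
    · exact ⟨j, fun x _ => by simp [slackRank]⟩
  have hcard : #((univ.erase i₀).image (Sum.inr : I → T ⊕ I)) + 1 = Fintype.card I := by
    rw [card_image_of_injective _ Sum.inr_injective, card_erase_add_one (mem_univ _), card_univ]
  refine ⟨hdom, hcard, ?_⟩
  obtain ⟨k, hk⟩ := exists_ne i₀
  obtain ⟨b, hb, hbmin⟩ := exists_min_image (univ.erase i₀) e ⟨k, by simp [hk]⟩
  have hbi : b ≠ i₀ := ne_of_mem_erase hb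
  -- All slack elements but `i₀` form the boundary door. The orders `i₀` and `b` share the minimum
  -- `Sum.inr b`, and nothing can enter for the order `b`.
  refine card_roomsOver_eq_one (slackRank_injective hr he hB) hdom hcard
    (m := fun i => if i = i₀ then Sum.inr b else Sum.inr i) (a := i₀) (b := b)
    ?_ ?_ hbi.symm (by simp [hbi]) ⟨Sum.inr i₀, ?_⟩ ?_
  · intro i
    split_ifs with h
    · exact hmemQ.2 ⟨b, hbi, rfl⟩
    · exact hmemQ.2 ⟨i, h, rfl⟩
  · intro i x hx
    obtain ⟨j, hj, rfl⟩ := hmemQ.1 hx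
    by_cases h : i = i₀
    · subst h
      have := hbmin j (by simp [hj])
      simp only [slackRank, if_true, if_neg hbi, if_neg hj]
      omega
    · simp [slackRank, h]
  · intro j hj
    simp [slackRank, hj, hj.symm]
  · rintro (t | j)
    · have := hB i₀ t
      refine ⟨i₀, hbi.symm, ?_⟩
      simp only [slackRank, if_true, if_neg hbi]
      omega
    · by_cases h : j = b
      · exact ⟨i₀, hbi.symm, by simp [h]⟩
      · exact ⟨j, h, by simp [slackRank]⟩

theorem card_roomsOver_of_inl_mem (hr : ∀ i, Function.Injective (r i))
    (he : Function.Injective e) (hB : ∀ i t, r i t < B) {Q : Finset (T ⊕ I)} {t : T}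
    (ht : Sum.inl t ∈ Q) (hQ : Dominant (slackRank r e B) Q) (hcard : #Q + 1 = Fintype.card I) :
    #(roomsOver (slackRank r e B) Q) = 2 := by
  refine card_roomsOver_eq_two (slackRank_injective hr he hB) hQ hcard ⟨_, ht⟩ fun a =>
    ⟨Sum.inr a, fun j hj => ⟨_, ht, ?_⟩⟩
  have := hB j t
  simp only [slackRank, if_neg hj.symm]
  omega

/-- Without a fully colored room, every room has an even number of doors. But the boundary door lies
in one room and every other door in two, so the number of incidences is odd. -/
theorem exists_dominant_image_eq_univ [Nonempty I] (hr : ∀ i, Function.Injective (r i))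
    (he : Function.Injective e) (hB : ∀ i t, r i t < B) (c : T → I) :
    ∃ P, Dominant (slackRank r e B) P ∧ P.image (Sum.elim c id) = univ := by
  classical
  rcases subsingleton_or_nontrivial I with hI | hI
  · obtain ⟨i⟩ := ‹Nonempty I›
    obtain ⟨x, -, hx⟩ := exists_max_image (univ : Finset (T ⊕ I)) (slackRank r e B i)
      ⟨Sum.inr i, mem_univ _⟩
    refine ⟨{x}, fun y => ⟨i, by simpa using hx y (mem_univ y)⟩, ?_⟩
    ext j
    simpa using Subsingleton.elim _ _
  obtain ⟨i₀⟩ := ‹Nonempty I›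
  by_contra! hcon
  have hsum := sum_card_doorsUnder (slackRank r e B) (Sum.elim c id) i₀
  obtain ⟨hd, hc, hone⟩ := card_roomsOver_slack hr he hB i₀
  have heven : Even (∑ P : Finset (T ⊕ I) with #P = Fintype.card I ∧
      Dominant (slackRank r e B) P, #(doorsUnder (slackRank r e B) (Sum.elim c id) i₀ P)) := by
    refine even_sum _ fun P hP => ?_
    simp only [mem_filter, mem_univ, true_and] at hP
    exact even_card_doorsUnder hP.1 hP.2 (hcon P hP.2)
  rw [hsum, ← add_sum_erase _ _ (a := (univ.erase i₀).image (Sum.inr : I → T ⊕ I)), hone] at heven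
  · refine absurd heven (Nat.not_even_iff_odd.2 (Even.one_add (even_sum _ fun Q hQ => ?_)))
    simp only [mem_erase, mem_filter, mem_univ, true_and] at hQ
    obtain ⟨hne, hcard, hdom, himg⟩ := hQ
    by_cases h : ∃ t, Sum.inl t ∈ Q
    · obtain ⟨t, ht⟩ := h
      rw [card_roomsOver_of_inl_mem hr he hB ht hdom hcard]
      exact even_two
    -- A slack element is colored by its index, so a door made of slack elements only is determined
    -- by its colors.
    · refine absurd ?_ hne
      rw [← himg, image_image]
      refine (image_id (s := Q)).symm.trans (image_congr fun x hx => ?_)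
      rcases x with t | j
      · exact absurd ⟨t, hx⟩ h
      · rfl
  · simp only [mem_filter, mem_univ, true_and]
    refine ⟨hc, hd, ?_⟩
    rw [image_image]
    exact image_id

end

/-- Scarf's lemma: a set `C` of orders and a set `σ` such that `σ` has every color in `C` and no
point lies, for every order in `C`, strictly above some point of `σ`. -/
theorem exists_colorful {T I : Type*} [Finite T] [Finite I] [Nonempty I] {r : I → T → ℕ}
    (hr : ∀ i, Function.Injective (r i)) (c : T → I) :
    ∃ (σ : Set T) (C : Set I), C ⊆ c '' σ ∧ ∀ y, ∃ i ∈ C, ∀ x ∈ σ, r i y ≤ r i x := by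
  classical
  have := Fintype.ofFinite T
  have := Fintype.ofFinite I
  obtain ⟨B, hB⟩ := (Set.finite_range (Function.uncurry r)).bddAbove
  have hB' : ∀ i t, r i t < B + 1 := fun i t => Nat.lt_succ_of_le (hB ⟨(i, t), rfl⟩)
  obtain ⟨P, hP, himg⟩ := exists_dominant_image_eq_univ hr
    (e := fun i => (Fintype.equivFin I i : ℕ))
    (Fin.val_injective.comp (Fintype.equivFin I).injective) hB' c
  -- An order whose slack element is in `P` cannot witness dominance over a point of `T`: that
  -- element has rank 0, points of `T` at least 1.
  refine ⟨{t | Sum.inl t ∈ P}, {i | Sum.inr i ∉ P}, fun i hi => ?_, fun y => ?_⟩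
  · obtain ⟨x, hx, hxi⟩ := mem_image.1 (himg ▸ mem_univ i)
    rcases x with t | j
    · exact ⟨t, hx, hxi⟩
    · exact absurd (show j = i from hxi ▸ rfl) fun h => hi (h ▸ hx)
  · obtain ⟨i, hi⟩ := hP (Sum.inl y)
    refine ⟨i, fun h => ?_, fun x hx => ?_⟩
    · have := hi _ h
      simp [slackRank] at this
    · simpa [slackRank] using hi _ hx

end Scarf

/-! ### Scarf's lemma on the grid of the simplex. -/

section Grid

open Finset

variable {I : Type*} [Fintype I] [DecidableEq I] [Nonempty I]

theorem Scarf.exists_colored_grid_points (N : ℕ) (c : (I → ℕ) → I) :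
    ∃ (p : I → I → ℕ) (C : Finset I), C.Nonempty ∧
      (∀ i ∈ C, c (p i) = i ∧ ∑ j, p i j = N) ∧
      (∀ i ∈ C, ∀ i' ∈ C, ∀ j, p i j ≤ p i' j + Fintype.card I) ∧
      ∀ i ∈ C, ∀ j ∉ C, p i j ≤ Fintype.card I := by
  classical
  let T := ↥((univ : Finset I).piAntidiag N)
  have hT : ∀ x : T, ∑ j, x.1 j = N := fun x => (mem_piAntidiag.1 x.2).1
  let e := Fintype.equivFin T
  -- Order by the coordinate `i`, ties being broken by the enumeration `e`.
  let r : I → T → ℕ := fun i x => x.1 i * Fintype.card T + e x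
  have hlt : ∀ (i : I) (x y : T), x.1 i < y.1 i → r i x < r i y := by
    intro i x y h
    have h₁ := Nat.mul_le_mul_right (Fintype.card T) (Nat.succ_le_of_lt h)
    have h₂ := (e x).2
    rw [Nat.succ_mul] at h₁
    simp only [r]
    omega
  have hr : ∀ i, Function.Injective (r i) := by
    intro i x y h
    have h₁ : x.1 i = y.1 i := le_antisymm (not_lt.1 fun h' => (hlt i y x h').ne' h)
      (not_lt.1 fun h' => (hlt i x y h').ne h)
    simp only [r, h₁, add_right_inj] at h
    exact e.injective (Fin.ext h)
  obtain ⟨σ, C', hC', hdom'⟩ := Scarf.exists_colorful hr fun x : T => c x.1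
  obtain ⟨C, rfl⟩ : ∃ C : Finset I, (C : Set I) = C' := ⟨C'.toFinset, by simp⟩
  obtain ⟨i₁⟩ := ‹Nonempty I›
  obtain ⟨i₀, hi₀, -⟩ := hdom' ⟨Pi.single i₁ N, by simp⟩
  obtain ⟨x₀, hx₀, -⟩ := hC' hi₀
  choose! q hq hqmin using fun j : I => Set.exists_min_image σ (fun x : T => x.1 j)
    (Set.toFinite _) ⟨x₀, hx₀⟩
  have hmin : ∀ x ∈ σ, ∀ j, (q j).1 j ≤ x.1 j := fun x hx j => hqmin j x hx
  -- Otherwise a grid point would exceed the minima of `σ` in every coordinate of `C`; the leftover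
  -- mass is put on `i₀ ∈ C`. So the minima nearly exhaust `N`, which leaves every point of `σ` a
  -- slack of less than `#C`.
  have hlarge : N < ∑ j ∈ C, ((q j).1 j + 1) := by
    by_contra! hle
    let y : I → ℕ := fun j => (if j ∈ C then (q j).1 j + 1 else 0) +
      (Pi.single i₀ (N - ∑ j ∈ C, ((q j).1 j + 1)) : I → ℕ) j
    have hy : ∑ j, y j = N := by
      simp only [y, sum_add_distrib, sum_ite_mem, univ_inter, sum_pi_single', mem_univ, if_true]
      have := sum_add_distrib (s := C) (f := fun j => (q j).1 j) (g := fun _ => 1)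
      omega
    obtain ⟨i, hi, hle⟩ := hdom' ⟨y, by simp [hy]⟩
    refine absurd (hle _ (hq i)) (not_le.2 (hlt i _ _ ?_))
    have : i ∈ C := hi
    simp only [y, if_pos this]
    omega
  have hcard : #C ≤ Fintype.card I := card_le_univ C
  rw [sum_add_distrib, sum_const, smul_eq_mul, mul_one] at hlarge
  have hnear : ∀ x ∈ σ, ∀ j ∈ C, x.1 j ≤ (q j).1 j + Fintype.card I := by
    intro x hx j hj
    have h₁ : ∑ j ∈ C, x.1 j ≤ N :=
      (sum_le_sum_of_subset (subset_univ C)).trans (hT x).le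
    have h₂ := add_sum_erase C (fun j => x.1 j) hj
    have h₃ := add_sum_erase C (fun j => (q j).1 j) hj
    have h₄ : ∑ j ∈ C.erase j, (q j).1 j ≤ ∑ j ∈ C.erase j, x.1 j :=
      sum_le_sum fun k _ => hmin x hx k
    omega
  have hsmall : ∀ x ∈ σ, ∀ j ∉ C, x.1 j ≤ Fintype.card I := by
    intro x hx j hj
    have h₁ : ∑ j ∈ insert j C, x.1 j ≤ N :=
      (sum_le_sum_of_subset (subset_univ _)).trans (hT x).le
    rw [sum_insert hj] at h₁
    have h₂ : ∑ j ∈ C, (q j).1 j ≤ ∑ j ∈ C, x.1 j := sum_le_sum fun k _ => hmin x hx k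
    omega
  have : Nonempty T := ⟨x₀⟩
  choose! p hp hpc using fun (i : I) (hi : i ∈ C) => hC' hi
  refine ⟨fun i => (p i).1, C, ⟨i₀, hi₀⟩, fun i hi => ⟨hpc i hi, hT _⟩, fun i hi i' hi' j => ?_,
    fun i hi j hj => hsmall _ (hp i hi) j hj⟩
  by_cases hj : j ∈ C
  · exact (hnear _ (hp i hi) j hj).trans (Nat.add_le_add_right (hmin _ (hp i' hi') j) _)
  · exact (hsmall _ (hp i hi) j hj).trans (Nat.le_add_left _ _)

end Grid

/-! ### Approximate equilibria and their limits. -/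

section Equilibrium

open Finset Filter Topology

variable {I : Type*} [Fintype I] [Nonempty I]

/-- Approximate solutions of the variational inequality on the simplex: every coordinate of
nonnegligible weight is almost maximal. -/
theorem exists_mem_stdSimplex_approx_max {g : (I → ℝ) → I → ℝ} (hg : Continuous g) {ε : ℝ}
    (hε : 0 < ε) :
    ∃ x ∈ stdSimplex ℝ I, ∀ i, ε < x i → ∀ j, g x j ≤ g x i + ε := by
  classical
  obtain ⟨δ, hδ, hgδ⟩ := Metric.uniformContinuousOn_iff.1
    ((isCompact_stdSimplex ℝ I).uniformContinuousOn_of_continuous hg.continuousOn) (ε / 2)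
    (half_pos hε)
  obtain ⟨N, hN⟩ := exists_nat_gt ((Fintype.card I : ℝ) / min δ ε)
  have hmin : 0 < min δ ε := lt_min hδ hε
  have hN₀ : (0 : ℝ) < N := lt_of_le_of_lt (by positivity) hN
  have hsmall : (Fintype.card I : ℝ) / N < min δ ε := (div_lt_comm₀ hmin hN₀).1 hN
  let φ : (I → ℕ) → I → ℝ := fun p j => p j / N
  choose c hc using fun p : I → ℕ => Finite.exists_max (g (φ p))
  obtain ⟨p, C, ⟨i₀, hi₀⟩, hp, hnear, hout⟩ := Scarf.exists_colored_grid_points N c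
  have hφ : ∀ i ∈ C, φ (p i) ∈ stdSimplex ℝ I := by
    refine fun i hi => ⟨fun j => by positivity, ?_⟩
    simp only [φ]
    rw [← sum_div, ← Nat.cast_sum, (hp i hi).2, div_self hN₀.ne']
  refine ⟨φ (p i₀), hφ i₀ hi₀, fun i hi j => ?_⟩
  -- Coordinates outside `C` are at most `card I / N < ε`.
  have hiC : i ∈ C := by
    by_contra h
    have h₁ : φ (p i₀) i ≤ Fintype.card I / N := by
      simp only [φ]
      gcongr
      exact hout i₀ hi₀ i h
    linarith [min_le_right δ ε]
  have hdist : dist (φ (p i₀)) (φ (p i)) < δ := by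
    refine (dist_pi_lt_iff hδ).2 fun k => lt_of_le_of_lt ?_ (hsmall.trans_le (min_le_left _ _))
    have h₁ : (p i₀ k : ℝ) ≤ p i k + Fintype.card I := mod_cast hnear i₀ hi₀ i hiC k
    have h₂ : (p i k : ℝ) ≤ p i₀ k + Fintype.card I := mod_cast hnear i hiC i₀ hi₀ k
    simp only [φ]
    rw [Real.dist_eq, ← sub_div, abs_div, abs_of_pos hN₀]
    gcongr
    rw [abs_le]
    constructor <;> linarith
  -- At `p i` the coordinate `i` is exactly maximal; moving to `p i₀` costs `ε / 2` on each side.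
  have hgd := (dist_pi_lt_iff (half_pos hε)).1 (hgδ _ (hφ i₀ hi₀) _ (hφ i hiC) hdist)
  have h₁ := abs_lt.1 (Real.dist_eq _ _ ▸ hgd j)
  have h₂ := abs_lt.1 (Real.dist_eq _ _ ▸ hgd i)
  have h₃ := hc (p i) j
  rw [(hp i hiC).1] at h₃
  linarith [h₁.2, h₂.1]

/-- A weight that is positive exactly at the coordinates of `v` that are maximal up to `ε`. -/
def approxMaxWeight (ε : ℝ) (v : I → ℝ) (k : I) : ℝ :=
  ∏ j, max 0 (v k - v j + ε)

omit [Nonempty I] in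
theorem approxMaxWeight_nonneg (ε : ℝ) (v : I → ℝ) (k : I) : 0 ≤ approxMaxWeight ε v k :=
  prod_nonneg fun _ _ => le_max_left _ _

theorem sum_approxMaxWeight_pos {ε : ℝ} (hε : 0 < ε) (v : I → ℝ) :
    0 < ∑ k, approxMaxWeight ε v k := by
  obtain ⟨k, hk⟩ := Finite.exists_max v
  refine sum_pos' (fun k _ => approxMaxWeight_nonneg ε v k) ⟨k, mem_univ k, ?_⟩
  exact prod_pos fun j _ => lt_max_of_lt_right (by linarith [hk j])

theorem exists_continuous_approx_max {ε : ℝ} (hε : 0 < ε) :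
    ∃ b : (I → ℝ) → I → ℝ, Continuous b ∧
      ∀ v, b v ∈ stdSimplex ℝ I ∧ ∀ k, 0 < b v k → ∀ j, v j ≤ v k + ε := by
  refine ⟨fun v k => approxMaxWeight ε v k / ∑ l, approxMaxWeight ε v l, ?_, fun v => ⟨⟨?_, ?_⟩, ?_⟩⟩
  · have hw : ∀ k, Continuous fun v : I → ℝ => approxMaxWeight ε v k := fun k => by
      unfold approxMaxWeight
      fun_prop
    exact continuous_pi fun k => (hw k).div (continuous_finsetSum _ fun l _ => hw l)
      fun v => (sum_approxMaxWeight_pos hε v).ne'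
  · exact fun k => div_nonneg (approxMaxWeight_nonneg ε v k) (sum_approxMaxWeight_pos hε v).le
  · rw [← sum_div, div_self (sum_approxMaxWeight_pos hε v).ne']
  · intro k hk j
    by_contra! h
    have h₀ : approxMaxWeight ε v k = 0 :=
      prod_eq_zero (mem_univ j) (max_eq_left (by linarith))
    simp [h₀] at hk

omit [Fintype I] [Nonempty I] in
theorem le_of_tendsto_approx_max {ε : ℕ → ℝ} (hε : Tendsto ε atTop (𝓝 0)) {s v : ℕ → I → ℝ}
    {s₀ v₀ : I → ℝ} (hs : Tendsto s atTop (𝓝 s₀)) (hv : Tendsto v atTop (𝓝 v₀))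
    (h : ∀ n i, ε n < s n i → ∀ j, v n j ≤ v n i + ε n) (i : I) (hi : 0 < s₀ i) (j : I) :
    v₀ j ≤ v₀ i := by
  have hs' := (tendsto_pi_nhds.1 hs) i
  have hv' := tendsto_pi_nhds.1 hv
  refine le_of_tendsto_of_tendsto (hv' j) (by simpa using (hv' i).add hε) ?_
  filter_upwards [hε.eventually_lt hs' hi] with n hn using h n i hn j

/-- Existence of an equilibrium in mixed strategies of a game between one player and a family of
players, in which the members of the family interact with the first player only. The values
`f w` and `v i s` are the payoffs of the pure strategies. -/
theorem exists_star_equilibrium {ι : Type*} [Finite ι] {f : (ι → I → ℝ) → I → ℝ}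
    (hf : Continuous f) {v : ι → (I → ℝ) → I → ℝ} (hv : ∀ i, Continuous (v i)) :
    ∃ s ∈ stdSimplex ℝ I, ∃ w : ι → I → ℝ, (∀ i, w i ∈ stdSimplex ℝ I) ∧
      (∀ k, 0 < s k → ∀ j, f w j ≤ f w k) ∧ ∀ i k, 0 < w i k → ∀ j, v i s j ≤ v i s k := by
  have hε : ∀ n : ℕ, (0 : ℝ) < 1 / ((n : ℝ) + 1) := fun n => Nat.one_div_pos_of_nat
  choose b hb hbmax using fun n => exists_continuous_approx_max (I := I) (hε n)
  -- Substituting the continuous replies eliminates the followers.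
  choose s hs hsmax using fun n => exists_mem_stdSimplex_approx_max (I := I)
    (g := fun x => f fun i => b n (v i x))
    (hf.comp (continuous_pi fun i => (hb n).comp (hv i))) (hε n)
  obtain ⟨⟨s₀, w₀⟩, ⟨hs₀, hw₀⟩, φ, hφ, hlim⟩ :=
    ((isCompact_stdSimplex ℝ I).prod
      (isCompact_univ_pi fun _ : ι => isCompact_stdSimplex ℝ I)).tendsto_subseq
      (x := fun n => (s n, fun i => b n (v i (s n))))
      fun n => ⟨hs n, fun i _ => (hbmax n _).1⟩
  have hlim₁ : Tendsto (fun n => s (φ n)) atTop (𝓝 s₀) := (continuous_fst.tendsto _).comp hlim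
  have hlim₂ : Tendsto (fun n i => b (φ n) (v i (s (φ n)))) atTop (𝓝 w₀) :=
    (continuous_snd.tendsto _).comp hlim
  have hεlim := tendsto_one_div_add_atTop_nhds_zero_nat (𝕜 := ℝ).comp hφ.tendsto_atTop
  refine ⟨s₀, hs₀, w₀, fun i => hw₀ i trivial, ?_, fun i => ?_⟩
  · exact le_of_tendsto_approx_max hεlim hlim₁ ((hf.tendsto _).comp hlim₂)
      fun n i hi => hsmax (φ n) i hi
  · exact le_of_tendsto_approx_max hεlim (tendsto_pi_nhds.1 hlim₂ i)
      (((hv i).tendsto _).comp hlim₁)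
      fun n k hk => (hbmax (φ n) _).2 k ((hε _).trans hk)

end Equilibrium

/-! ### Application to the security game. -/

namespace SecurityGame

open Finset

theorem smul_mem_allocations {K : ℕ} {R : ℝ} (hR : 0 ≤ R) {s : Fin K → ℝ}
    (hs : s ∈ stdSimplex ℝ (Fin K)) : R • s ∈ allocations K R :=
  ⟨by simp [← mul_sum, hs.2], fun k => mul_nonneg hR (hs.1 k)⟩

/-- An allocation that uses only targets of maximal value maximizes the total value. -/
theorem sum_mul_le_sum_smul_mul {K : ℕ} {R : ℝ} {s v : Fin K → ℝ}
    (hs : s ∈ stdSimplex ℝ (Fin K)) (hmax : ∀ k, 0 < s k → ∀ j, v j ≤ v k) {x : Fin K → ℝ}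
    (hx : x ∈ allocations K R) : ∑ k, x k * v k ≤ ∑ k, (R • s) k * v k := by
  obtain ⟨k, hk⟩ : ∃ k, 0 < s k := by
    by_contra! h
    have := sum_nonpos fun k (_ : k ∈ univ) => h k
    linarith [hs.2]
  have h₁ : ∑ k, x k * v k ≤ R * v k := by
    rw [← hx.1, sum_mul]
    exact sum_le_sum fun j _ => mul_le_mul_of_nonneg_left (hmax k hk j) (hx.2 j)
  have h₂ : ∑ j, (R • s) j * v j = R * v k := by
    calc ∑ j, (R • s) j * v j = ∑ j, R * (s j * v k) := by
          refine sum_congr rfl fun j _ => ?_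
          rw [Pi.smul_apply, smul_eq_mul, mul_assoc]
          rcases (hs.1 j).eq_or_lt with h | h
          · simp [← h]
          · rw [le_antisymm (hmax k hk j) (hmax j h k)]
      _ = R * v k := by rw [← mul_sum, ← sum_mul, hs.2, one_mul]
  exact h₁.trans h₂.ge

/-- The second sum does not involve `x`, so only the linear part matters for the leader's choice. -/
theorem Game.leaderUtility_eq {n K : ℕ} (G : Game n K) (x : Fin K → ℝ) (y : Fin n → Fin K → ℝ) :
    G.leaderUtility x y =
      ∑ k, x k * ((∑ i, y i k) * (G.leaderCovered k - G.leaderUncovered k)) +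
        ∑ k, (∑ i, y i k) * (G.leaderResource * G.leaderUncovered k) := by
  rw [Game.leaderUtility, ← sum_add_distrib]
  exact sum_congr rfl fun k _ => by ring

end SecurityGame

theorem mainTheorem3 (n K m : ℕ) (hK : 0 < K)
    (G : SecurityGame.ParametricGame n K m)
    (hRl : 0 ≤ G.leaderResource)
    (hRf : ∀ i, 0 ≤ G.followerResource i)
    (Θ : Set (EuclideanSpace ℝ (Fin m))) (θ₀ : EuclideanSpace ℝ (Fin m))
    (hΘ_compact : IsCompact Θ) (hΘ_convex : Convex ℝ Θ)
    (hΘ_int : (interior Θ).Nonempty) (hθ₀ : θ₀ ∈ Θ)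
    (hdiff_c : ∀ i k, DifferentiableOn ℝ (fun θ => G.followerCovered i θ k) Θ)
    (hdiff_u : ∀ i k, DifferentiableOn ℝ (fun θ => G.followerUncovered i θ k) Θ)
    (θ' : Θ) :
    ∃ (x : Fin K → ℝ) (y : Fin n → Fin K → ℝ), (G.hypergame Θ θ₀ θ').IsHyperNash x y := by
  have : Nonempty (Fin K) := ⟨⟨0, hK⟩⟩
  obtain ⟨s, hs, w, hw, hsmax, hwmax⟩ := exists_star_equilibrium (I := Fin K) (ι := Fin n)
    (f := fun w k => (∑ i, (G.followerResource i • w i) k) *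
      (G.leaderCovered k - G.leaderUncovered k))
    (v := fun i s k => (G.leaderResource • s) k * G.followerCovered i θ' k +
      (G.leaderResource - (G.leaderResource • s) k) * G.followerUncovered i θ' k)
    (by simp only [Pi.smul_apply]; fun_prop) (fun i => by simp only [Pi.smul_apply]; fun_prop)
  refine ⟨G.leaderResource • s, fun i => G.followerResource i • w i,
    ⟨SecurityGame.smul_mem_allocations hRl hs, fun x hx => ?_⟩,
    fun i => ⟨SecurityGame.smul_mem_allocations (hRf i) (hw i), fun y hy => ?_⟩⟩
  · simp only [SecurityGame.Game.leaderUtility_eq]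
    exact add_le_add_left (SecurityGame.sum_mul_le_sum_smul_mul hs hsmax hx) _
  · exact SecurityGame.sum_mul_le_sum_smul_mul (hw i) (hwmax i) hy
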